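/- For a compact set $K\subset\mathbb{R}$ of positive Lebesgue measure $|K|=\lambda(K)>0$, let $L^\infty(K)$ be the real space of (classes of) essentially bounded functions on $K$. For $f\in L^\infty(K)$ put $$J_Kf(x)=\int_{[\min K,x]\cap K} f\,d\lambda\quad(x\in K),\qquad \|f\|_A=\sup_{x\in K}|J_Kf(x)|,$$ where $\|\cdot\|_A$ is called the Alexiewicz norm. Let $\pi_K:K\to[0,|K|]$, $\pi_K(x)=\lambda([\min K,x]\cap K)$, and $\sigma_K:[0,|K|]\to K$, $\sigma_K(t)=\min\{x\in K:\pi_K(x)=t\}$. Theorem. Let $K,M\subset\mathbb{R}$ be compact sets of positive Lebesgue measure. A linear map $T:(L^\infty(K),\|\cdot\|_A)\to(L^\infty(M),\|\cdot\|_A)$ is a surjective isometry if and only if there exist $\varepsilon\in\{1,-1\}$ and an increasing bi-Lipschitz homeomorphism $\psi:[0,|M|]\to[0,|K|]$ such that the map $\phi=\sigma_K\circ\psi\circ\pi_M:M\to K$ satisfies $$J_M(Tf)(y)=\varepsilon\,(J_Kf)(\phi(y))\qquad\text{for all } y\in M \tag{1}$$ for every $f\in L^\infty(K)$. Moreover,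 for every linear map $T:L^\infty(K)\to L^\infty(M)$, every such $\varepsilon$ and $\psi$ (with $\phi=\sigma_K\circ\psi\circ\pi_M$) and every $f\in L^\infty(K)$, condition (1) is equivalent to $$(Tf)(y)=\varepsilon\,f(\phi(y))\,\psi'(\pi_M(y))\qquad\text{for a.e. } y\in M. \tag{2}$$ -/

import Mathlib

namespace Alexiewicz

open MeasureTheory Set

/-- The real space `L^∞(K)` for Lebesgue measure on `K ⊆ ℝ`
(classes of essentially bounded functions modulo equality a.e. on `K`). -/
abbrev LInf (K : Set ℝ) : Type :=
  Lp ℝ ⊤ ((volume : Measure ℝ).restrict K)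

/-- The primitive `J_K f (x) = ∫_{[min K, x] ∩ K} f dλ`. For nonempty compact `K`, `sInf K` is
`min K`. -/
noncomputable def primitive (K : Set ℝ) (f : LInf K) (x : ℝ) : ℝ :=
  ∫ u in Icc (sInf K) x ∩ K, f u

/-- The Alexiewicz norm `‖f‖_A = sup_{x ∈ K} |J_K f (x)|`. -/
noncomputable def alexNorm (K : Set ℝ) (f : LInf K) : ℝ :=
  sSup ((fun x => |primitive K f x|) '' K)

/-- The measure projection `π_K(x) = λ([min K, x] ∩ K)`. -/
noncomputable def proj (K : Set ℝ) (x : ℝ) : ℝ :=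
  volume.real (Icc (sInf K) x ∩ K)

/-- The left-endpoint selector `σ_K(t) = min {x ∈ K : π_K(x) = t}`, used for `t ∈ [0, |K|]`. If `K`
is compact of positive measure, that fiber is nonempty and compact, so `sInf` is its minimum. -/
noncomputable def sel (K : Set ℝ) (t : ℝ) : ℝ :=
  sInf {x ∈ K | proj K x = t}

/-- `ψ` restricts to an increasing lipeomorphism (bi-Lipschitz homeomorphism)
`[0, a] → [0, b]`. Values of `ψ` outside `[0, a]` are irrelevant. -/
structure IsIncreasingLipeo (a b : ℝ) (ψ : ℝ → ℝ) : Prop where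
  strictMonoOn : StrictMonoOn ψ (Icc 0 a)
  bijOn : BijOn ψ (Icc 0 a) (Icc 0 b)
  lipschitz : ∃ C, LipschitzOnWith C ψ (Icc 0 a)
  antilipschitz : ∃ C, AntilipschitzWith C (fun t : Icc (0 : ℝ) a => ψ t)

/-- `φ = σ_K ∘ ψ ∘ π_M`, used on `M`. -/
noncomputable def lift (K M : Set ℝ) (ψ : ℝ → ℝ) (y : ℝ) : ℝ :=
  sel K (ψ (proj M y))

/-- `T` is a surjective isometry `(L^∞(K), ‖·‖_A) → (L^∞(M), ‖·‖_A)`. -/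
def IsSurjectiveIsometry {K M : Set ℝ} (T : LInf K →ₗ[ℝ] LInf M) : Prop :=
  Function.Surjective T ∧ ∀ f : LInf K, alexNorm M (T f) = alexNorm K f

end Alexiewicz

/-!
The selector `σ_K` pushes Lebesgue measure on `[0, |K|]` forward to Lebesgue measure on `K` and is
an a.e. inverse of `π_K`. Transported along it, `J_K` becomes the usual primitive, and since
Lipschitz functions are the primitives of bounded functions, `J_K` identifies `(L^∞(K), ‖·‖_A)`
isometrically with the space of Lipschitz functions on `[0, |K|]` vanishing at `0`, under the sup
norm.

Surjective isometries `T` between two such spaces, on `[0, a]` and `[0, b]`, are described by a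
Banach–Stone argument. For `0 ≠ y ∈ [0, b]`, the images under `T⁻¹` of the norm-one functions with
value `1` at `y` form a convex subset of the unit sphere of `C([0, a])`, so by compactness they
share a peak `x` with a common sign. A Lipschitz function vanishing at `y` can be hidden, after
scaling, under a steep tent with apex `y`; hence `T⁻¹ f` vanishes at `x` if `f` vanishes at `y`, and
`(T⁻¹ f)(x) = ±f(y)` for all `f`. The sign is constant because `(0, b]` is connected, and `y ↦ x` is
Lipschitz because it is, up to sign, the image under `T` of the identity function.

Finally, (1) says that two Lipschitz functions on `[0, |M|]` agree and (2) that their derivatives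
agree a.e.; bi-Lipschitz maps preserve null sets, so the chain rule holds a.e.
-/

namespace Alexiewicz

open MeasureTheory Set
open scoped NNReal

section LipZero

variable {X : Type*} [MetricSpace X] {o x : X}

/-- The space `Lip₀(X, o)` of real Lipschitz functions on `X` that vanish at the base point `o`. As
a submodule of `C(X, ℝ)` it carries, for compact `X`, the sup norm and not the Lipschitz norm. -/
def lipZero (o : X) : Submodule ℝ C(X, ℝ) where
  carrier := {f | f o = 0 ∧ ∃ C, LipschitzWith C f}
  add_mem' := by
    rintro f g ⟨hf, C, hC⟩ ⟨hg, D, hD⟩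
    exact ⟨by simp [hf, hg], _, hC.add hD⟩
  zero_mem' := ⟨rfl, 0, LipschitzWith.const 0⟩
  smul_mem' := by
    rintro c f ⟨hf, C, hC⟩
    exact ⟨by simp [hf], _, (lipschitzWith_smul c).comp hC⟩

/-- The element of `lipZero o` given by a Lipschitz function vanishing at `o`. -/
def lipZero.ofLipschitz {f : X → ℝ} {C : ℝ≥0} (hf : LipschitzWith C f) (h0 : f o = 0) :
    lipZero o :=
  ⟨⟨f, hf.continuous⟩, h0, C, hf⟩

lemma exists_tent (hx : x ≠ o) {r : ℝ} (hr : 0 ≤ r) :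
    ∃ g : lipZero o, ∃ c, r ≤ c ∧ ∀ y, g.1 y = max 0 (1 - c * dist y x) := by
  have hd : 0 < dist o x := dist_pos.2 hx.symm
  set c : ℝ := r + (dist o x)⁻¹
  have hLip := ((LipschitzWith.const (1 : ℝ)).sub
    ((lipschitzWith_smul c).comp (LipschitzWith.dist_left x))).const_max 0
  have hc : 1 - c * dist o x ≤ 0 := by
    rw [add_mul, inv_mul_cancel₀ hd.ne']
    linarith [mul_nonneg hr hd.le]
  exact ⟨lipZero.ofLipschitz hLip (max_eq_left hc), c,
    le_add_of_nonneg_right (inv_nonneg.2 hd.le), fun _ => rfl⟩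

variable [CompactSpace X]

/-- The functions in the closed unit ball of `Lip₀(X, o)` that take the value `1` at `x`. This is
the face of the unit ball on which evaluation at `x` is maximal. -/
def peakSet (o x : X) : Set (lipZero o) := {f | ‖f‖ ≤ 1 ∧ f.1 x = 1}

lemma convex_peakSet : Convex ℝ (peakSet o x) := by
  rintro f ⟨hf, hfx⟩ g ⟨hg, hgx⟩ s t hs ht hst
  refine ⟨?_, by simp [hfx, hgx, hst]⟩
  calc ‖s • f.1 + t • g.1‖ ≤ ‖s • f.1‖ + ‖t • g.1‖ := norm_add_le _ _
    _ = s * ‖f.1‖ + t * ‖g.1‖ := by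
      rw [norm_smul, norm_smul, Real.norm_of_nonneg hs, Real.norm_of_nonneg ht]
    _ ≤ s * 1 + t * 1 := by
      gcongr
      exacts [hf, hg]
    _ = 1 := by rw [mul_one, mul_one, hst]

lemma norm_eq_one_of_mem_peakSet {f : lipZero o} (hf : f ∈ peakSet o x) : ‖f‖ = 1 :=
  hf.1.antisymm (by simpa [hf.2] using f.1.norm_coe_le_norm x)

lemma mem_peakSet_of_abs_le {f : lipZero o} (hf : ∀ y, |f.1 y| ≤ 1) (hfx : f.1 x = 1) :
    f ∈ peakSet o x :=
  ⟨(ContinuousMap.norm_le _ zero_le_one).2 hf, hfx⟩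

/-- A small multiple of a Lipschitz function vanishing at `x` can be hidden under a steep tent with
apex `x`. -/
lemma exists_add_smul_mem_peakSet (hx : x ≠ o) {f : lipZero o} (hf : f.1 x = 0) :
    ∃ g ∈ peakSet o x, ∃ δ : ℝ, δ ≠ 0 ∧ g + δ • f ∈ peakSet o x := by
  obtain ⟨-, L, hL⟩ := f.2
  set δ : ℝ := (‖f‖ + 1)⁻¹
  have hδ : 0 < δ := by positivity
  obtain ⟨g, c, hc, hg⟩ := exists_tent hx (r := δ * L) (by positivity)
  have hgx : g.1 x = 1 := by simp [hg]
  have hfbound (y : X) : |δ * f.1 y| ≤ 1 := by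
    rw [abs_mul, abs_of_pos hδ, inv_mul_le_one₀ (by positivity)]
    exact (f.1.norm_coe_le_norm y).trans (le_add_of_nonneg_right zero_le_one)
  have hflip (y : X) : |δ * f.1 y| ≤ c * dist y x := by
    have hfy : |f.1 y| ≤ L * dist y x := by simpa [Real.dist_eq, hf] using hL.dist_le_mul y x
    calc |δ * f.1 y| = δ * |f.1 y| := by rw [abs_mul, abs_of_pos hδ]
      _ ≤ δ * (L * dist y x) := by gcongr
      _ = δ * L * dist y x := by ring
      _ ≤ c * dist y x := by gcongr
  refine ⟨g, mem_peakSet_of_abs_le (fun y => ?_) hgx, δ, hδ.ne',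
    mem_peakSet_of_abs_le (fun y => ?_) (by simp [hgx, hf])⟩
  · have : 0 ≤ c * dist y x := (abs_nonneg _).trans (hflip y)
    rw [hg, abs_of_nonneg (le_max_left _ _)]
    exact max_le zero_le_one (by linarith)
  · change |g.1 y + δ * f.1 y| ≤ 1
    have h1 := abs_le.1 (hfbound y)
    have h2 := abs_le.1 (hflip y)
    rw [hg, abs_le]
    rcases max_cases 0 (1 - c * dist y x) with ⟨h, _⟩ | ⟨h, _⟩ <;> rw [h] <;>
      constructor <;> linarith

lemma peakSet_nonempty (hx : x ≠ o) : (peakSet o x).Nonempty :=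
  let ⟨g, hg, _⟩ := exists_add_smul_mem_peakSet hx (f := 0) rfl
  ⟨g, hg⟩

variable {Y : Type*} [TopologicalSpace Y] [CompactSpace Y]

lemma exists_norm_apply_eq_norm [Nonempty Y] (f : C(Y, ℝ)) : ∃ y, ‖f y‖ = ‖f‖ := by
  obtain ⟨y, -, hy⟩ := isCompact_univ.exists_isMaxOn univ_nonempty
    (f := fun y => ‖f y‖) (by fun_prop)
  exact ⟨y, (f.norm_coe_le_norm y).antisymm
    ((ContinuousMap.norm_le_of_nonempty _).2 fun z => hy (mem_univ z))⟩

/-- A midpoint of `f` and `g` can only peak where both peak with the same sign, so the sets of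
signed peaks are directed. -/
theorem exists_common_peak {S : Set C(Y, ℝ)} (hS : Convex ℝ S) (hne : S.Nonempty)
    (hnorm : ∀ f ∈ S, ‖f‖ = 1) : ∃ y, ∃ s : ℝ, |s| = 1 ∧ ∀ f ∈ S, f y = s := by
  have : Nonempty S := hne.to_subtype
  have : Nonempty Y := by
    by_contra hY
    obtain ⟨f, hf⟩ := hne
    rw [not_nonempty_iff] at hY
    simpa [Subsingleton.elim f 0] using hnorm f hf
  let peaks (f : S) : Set (Y × Metric.sphere (0 : ℝ) 1) := {p | f.1 p.1 = p.2}
  have hclosed (f : S) : IsClosed (peaks f) := by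
    refine isClosed_eq ?_ ?_ <;> fun_prop
  have hpeaks (f : S) : (peaks f).Nonempty := by
    obtain ⟨y, hy⟩ := exists_norm_apply_eq_norm f.1
    exact ⟨(y, ⟨f.1 y, mem_sphere_zero_iff_norm.2 (hy.trans (hnorm f f.2))⟩), rfl⟩
  have hdir : Directed (· ⊇ ·) peaks := by
    intro f g
    refine ⟨⟨midpoint ℝ f.1 g.1, hS.midpoint_mem f.2 g.2⟩, ?_⟩
    have key (p : Y × Metric.sphere (0 : ℝ) 1) (hp : midpoint ℝ f.1 g.1 p.1 = p.2) :
        f.1 p.1 = p.2 ∧ g.1 p.1 = p.2 := by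
      have hf := abs_le.1 ((f.1.norm_coe_le_norm p.1).trans_eq (hnorm f f.2))
      have hg := abs_le.1 ((g.1.norm_coe_le_norm p.1).trans_eq (hnorm g g.2))
      have hmid : (f.1 p.1 + g.1 p.1) / 2 = p.2 := by
        rw [← hp, midpoint_eq_smul_add]
        simp [div_eq_inv_mul, mul_add]
      have hs : |(p.2 : ℝ)| = 1 := mem_sphere_zero_iff_norm.1 p.2.2
      rcases (abs_eq zero_le_one).1 hs with h | h <;> constructor <;> linarith
    exact ⟨fun p hp => (key p hp).1, fun p hp => (key p hp).2⟩
  obtain ⟨⟨y, s⟩, hys⟩ := IsCompact.nonempty_iInter_of_directed_nonempty_isCompact_isClosed peaks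
    hdir hpeaks (fun f => (hclosed f).isCompact) hclosed
  exact ⟨y, s, mem_sphere_zero_iff_norm.1 s.2, fun f hf => mem_iInter.1 hys ⟨f, hf⟩⟩

theorem exists_apply_eq_mul_of_linearIsometry (T : lipZero o →ₗᵢ[ℝ] C(Y, ℝ)) (hx : x ≠ o) :
    ∃ y, ∃ s : ℝ, |s| = 1 ∧ ∀ f, T f y = s * f.1 x := by
  obtain ⟨y, s, hs, hT⟩ := exists_common_peak (S := T '' peakSet o x)
    (convex_peakSet.linear_image T.toLinearMap)
    ((peakSet_nonempty hx).image T)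
    (by
      rintro _ ⟨f, hf, rfl⟩
      rw [T.norm_map, norm_eq_one_of_mem_peakSet hf])
  have hpeak {f : lipZero o} (hf : f ∈ peakSet o x) : T f y = s := hT _ ⟨f, hf, rfl⟩
  have hker {f : lipZero o} (hf : f.1 x = 0) : T f y = 0 := by
    obtain ⟨g, hg, δ, hδ, hgf⟩ := exists_add_smul_mem_peakSet hx hf
    have := hpeak hgf
    rw [T.map_add, T.map_smul, ContinuousMap.add_apply, ContinuousMap.smul_apply, hpeak hg,
      add_eq_left, smul_eq_mul] at this
    exact (mul_eq_zero.1 this).resolve_left hδ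
  obtain ⟨g, hg⟩ := peakSet_nonempty hx
  refine ⟨y, s, hs, fun f => ?_⟩
  have : T (f - f.1 x • g) y = 0 := hker (by simp [hg.2])
  rw [T.map_sub, T.map_smul, ContinuousMap.sub_apply, ContinuousMap.smul_apply, hpeak hg,
    smul_eq_mul, sub_eq_zero] at this
  rw [this, mul_comm]

variable {Z : Type*} [MetricSpace Z] [CompactSpace Z] {o' y : Z}

theorem exists_apply_eq_mul_of_linearIsometryEquiv (T : lipZero o ≃ₗᵢ[ℝ] lipZero o') (hy : y ≠ o') :
    ∃ x ≠ o, ∃ s : ℝ, |s| = 1 ∧ ∀ f, (T f).1 y = s * f.1 x := by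
  obtain ⟨x, s, hs, hT⟩ := exists_apply_eq_mul_of_linearIsometry
    ((lipZero o).subtypeₗᵢ.comp T.symm.toLinearIsometry) hy
  have hT (f : lipZero o) : f.1 x = s * (T f).1 y := by simpa using hT (T f)
  refine ⟨x, ?_, s, hs, fun f => ?_⟩
  · rintro rfl
    obtain ⟨g, hg⟩ := peakSet_nonempty hy
    have h := hT (T.symm g)
    rw [(T.symm g).2.1, T.apply_symm_apply, hg.2, mul_one] at h
    simp [← h] at hs
  · rw [hT f, ← mul_assoc, ← abs_mul_abs_self s, hs, one_mul, one_mul]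

end LipZero

section Interval

variable {a b : ℝ} {ha : 0 ≤ a} {hb : 0 ≤ b}

/-- The base point `0` of `[0, a]`. -/
def origin (ha : 0 ≤ a) : Icc 0 a :=
  ⟨0, left_mem_Icc.2 ha⟩

/-- The inclusion `[0, a] → ℝ` as an element of `Lip₀([0, a], 0)`. -/
def inclusion (ha : 0 ≤ a) : lipZero (origin ha) :=
  lipZero.ofLipschitz (LipschitzWith.subtype_val (Icc 0 a)) rfl

lemma inclusion_apply (x : Icc 0 a) : (inclusion ha).1 x = x := rfl

lemma isPreconnected_ne_origin : IsPreconnected {y | y ≠ origin hb} := by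
  rw [← Topology.IsInducing.subtypeVal.isPreconnected_image]
  convert isPreconnected_Ioc (a := (0 : ℝ)) (b := b)
  ext y
  constructor
  · rintro ⟨y, hy, rfl⟩
    exact ⟨y.2.1.lt_of_ne' fun h => hy (Subtype.ext h), y.2.2⟩
  · rintro ⟨h0, hb⟩
    exact ⟨⟨y, h0.le, hb⟩, fun h => h0.ne' (congrArg Subtype.val h), rfl⟩

lemma exists_sign_of_ne_zero {u : Icc 0 b → ℝ} (hu : Continuous u)
    (hu0 : ∀ y ≠ origin hb, u y ≠ 0) :
    ∃ ε : ℝ, (ε = 1 ∨ ε = -1) ∧ ∀ y ≠ origin hb, u y = ε * |u y| := by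
  rcases isPreconnected_ne_origin.eq_or_eq_neg_of_sq_eq hu.continuousOn hu.abs.continuousOn
    (fun y _ => (sq_abs (u y)).symm) (fun hy => abs_ne_zero.2 (hu0 _ hy)) with h | h
  · exact ⟨1, .inl rfl, fun y hy => by rw [one_mul]; exact h hy⟩
  · exact ⟨-1, .inr rfl, fun y hy => by rw [neg_one_mul]; exact h hy⟩

theorem exists_lipschitz_of_linearIsometryEquiv
    (T : lipZero (origin ha) ≃ₗᵢ[ℝ] lipZero (origin hb)) :
    ∃ ε : ℝ, (ε = 1 ∨ ε = -1) ∧ ∃ η : Icc 0 b → Icc 0 a, (∃ C, LipschitzWith C η) ∧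
      η (origin hb) = origin ha ∧ ∀ f y, (T f).1 y = ε * f.1 (η y) := by
  set u : lipZero (origin hb) := T (inclusion ha)
  have hu {y : Icc 0 b} (hy : y ≠ origin hb) :
      ∃ x : Icc 0 a, x.1 ≠ 0 ∧ ∃ s : ℝ, |s| = 1 ∧ u.1 y = s * x ∧ ∀ f, (T f).1 y = s * f.1 x := by
    obtain ⟨x, hx, s, hs, hT⟩ := exists_apply_eq_mul_of_linearIsometryEquiv T hy
    exact ⟨x, fun h => hx (Subtype.ext h), s, hs, hT _, hT⟩
  have hu_ne (y : Icc 0 b) (hy : y ≠ origin hb) : u.1 y ≠ 0 := by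
    obtain ⟨x, hx, s, hs, hux, -⟩ := hu hy
    rw [hux]
    exact mul_ne_zero (abs_ne_zero.1 (hs ▸ one_ne_zero)) hx
  obtain ⟨ε, hε, hsign⟩ := exists_sign_of_ne_zero u.1.continuous hu_ne
  have hη (y : Icc 0 b) : ∃ x : Icc 0 a, x = |u.1 y| ∧ ∀ f, (T f).1 y = ε * f.1 x := by
    by_cases hy : y = origin hb
    · subst hy
      exact ⟨origin ha, by rw [u.2.1, abs_zero]; rfl, fun f => by rw [(T f).2.1, f.2.1, mul_zero]⟩
    · obtain ⟨x, -, s, hs, hux, hT⟩ := hu hy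
      have hx : x = |u.1 y| := by rw [hux, abs_mul, hs, one_mul, abs_of_nonneg x.2.1]
      have hsε : s = ε :=
        mul_right_cancel₀ (abs_ne_zero.2 (hu_ne y hy)) (by rw [← hsign y hy, ← hx, hux])
      exact ⟨x, hx, hsε ▸ hT⟩
  choose η hηu hηT using hη
  obtain ⟨-, C, hC⟩ := u.2
  refine ⟨ε, hε, η, ⟨C, LipschitzWith.of_dist_le_mul fun y z => ?_⟩,
    Subtype.ext (by rw [hηu, u.2.1, abs_zero]; rfl), fun f y => hηT y f⟩
  calc dist (η y) (η z) = |(|u.1 y| - |u.1 z|)| := by rw [← hηu, ← hηu]; rfl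
    _ ≤ |u.1 y - u.1 z| := abs_abs_sub_abs_le_abs_sub _ _
    _ ≤ C * dist y z := hC.dist_le_mul y z

lemma leftInverse_of_linearIsometryEquiv {T : lipZero (origin ha) ≃ₗᵢ[ℝ] lipZero (origin hb)}
    {ε δ : ℝ} (hε : |ε| = 1) (hδ : |δ| = 1) {η : Icc 0 b → Icc 0 a} {θ : Icc 0 a → Icc 0 b}
    (hη : ∀ f y, (T f).1 y = ε * f.1 (η y)) (hθ : ∀ f x, (T.symm f).1 x = δ * f.1 (θ x)) :
    Function.LeftInverse η θ := fun x => by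
  have h := hθ (T (inclusion ha)) x
  rw [T.symm_apply_apply, hη, inclusion_apply, inclusion_apply] at h
  have h' := congrArg abs h
  rw [abs_mul, abs_mul, hε, hδ, one_mul, one_mul, abs_of_nonneg x.2.1,
    abs_of_nonneg (η (θ x)).2.1] at h'
  exact Subtype.ext h'.symm

/-- The Banach–Stone theorem for `Lip₀([0, a], 0)`. -/
theorem exists_lipeo_of_linearIsometryEquiv (T : lipZero (origin ha) ≃ₗᵢ[ℝ] lipZero (origin hb)) :
    ∃ ε : ℝ, (ε = 1 ∨ ε = -1) ∧ ∃ e : Icc 0 b ≃ Icc 0 a, (∃ C, LipschitzWith C e) ∧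
      (∃ C, LipschitzWith C e.symm) ∧ e (origin hb) = origin ha ∧
      ∀ f y, (T f).1 y = ε * f.1 (e y) := by
  have abs_eq_one {ε : ℝ} (hε : ε = 1 ∨ ε = -1) : |ε| = 1 := (abs_eq zero_le_one).2 hε
  obtain ⟨ε, hε, η, hηLip, hη0, hη⟩ := exists_lipschitz_of_linearIsometryEquiv T
  obtain ⟨δ, hδ, θ, hθLip, -, hθ⟩ := exists_lipschitz_of_linearIsometryEquiv T.symm
  exact ⟨ε, hε, ⟨η, θ,
    leftInverse_of_linearIsometryEquiv (T := T.symm) (abs_eq_one hδ) (abs_eq_one hε) hθ hη,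
    leftInverse_of_linearIsometryEquiv (abs_eq_one hε) (abs_eq_one hδ) hη hθ⟩,
    hηLip, hθLip, hη0, hη⟩

/-- The homeomorphism `[0, b] → [0, a]` underlying an increasing lipeomorphism. -/
noncomputable def IsIncreasingLipeo.equiv {ψ : ℝ → ℝ} (hψ : IsIncreasingLipeo b a ψ) :
    Icc 0 b ≃ Icc 0 a :=
  hψ.bijOn.equiv ψ

lemma IsIncreasingLipeo.exists_lipschitzWith_equiv_symm {ψ : ℝ → ℝ}
    (hψ : IsIncreasingLipeo b a ψ) : ∃ C, LipschitzWith C hψ.equiv.symm :=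
  let ⟨C, hC⟩ := hψ.antilipschitz
  ⟨C, AntilipschitzWith.to_rightInverse (f := hψ.equiv) hC hψ.equiv.right_inv⟩

lemma IsIncreasingLipeo.apply_zero {ψ : ℝ → ℝ} (hψ : IsIncreasingLipeo b a ψ) (ha : 0 ≤ a)
    (hb : 0 ≤ b) : ψ 0 = 0 := by
  obtain ⟨y, hy, hy0⟩ := hψ.bijOn.surjOn (left_mem_Icc.2 ha)
  exact ((hψ.strictMonoOn.monotoneOn (left_mem_Icc.2 hb) hy hy.1).trans_eq hy0).antisymm
    (hψ.bijOn.mapsTo (left_mem_Icc.2 hb)).1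

lemma exists_isIncreasingLipeo_equiv_eq {e : Icc 0 b ≃ Icc 0 a} (he : ∃ C, LipschitzWith C e)
    (he' : ∃ C, LipschitzWith C e.symm) (he0 : e (origin hb) = origin ha) :
    ∃ ψ, ∃ hψ : IsIncreasingLipeo b a ψ, hψ.equiv = e := by
  obtain ⟨C, hC⟩ := he
  obtain ⟨D, hD⟩ := he'
  set ψ := IccExtend hb fun y => (e y : ℝ)
  have hψ (y : Icc 0 b) : ψ y = e y := IccExtend_val hb _ y
  have hbij : BijOn ψ (Icc 0 b) (Icc 0 a) := by
    refine ⟨fun y hy => ?_, fun y hy z hz h => ?_, fun x hx => ?_⟩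
    · exact hψ ⟨y, hy⟩ ▸ (e ⟨y, hy⟩).2
    · rw [hψ ⟨y, hy⟩, hψ ⟨z, hz⟩] at h
      exact congrArg Subtype.val (e.injective (Subtype.ext h))
    · exact ⟨e.symm ⟨x, hx⟩, (e.symm ⟨x, hx⟩).2, by rw [hψ, e.apply_symm_apply]⟩
  have hLip : LipschitzOnWith C ψ (Icc 0 b) :=
    lipschitzOnWith_iff_restrict.2 <| by
      convert (LipschitzWith.subtype_val _).comp hC using 1
      · rw [one_mul]
      · exact funext hψ
  have hmono : StrictMonoOn ψ (Icc 0 b) := by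
    refine hLip.continuousOn.strictMonoOn_of_injOn_Icc hb ?_ hbij.injOn
    exact ((hψ (origin hb)).trans (congrArg Subtype.val he0)).trans_le
      (hbij.mapsTo (right_mem_Icc.2 hb)).1
  have hanti : AntilipschitzWith D fun y : Icc 0 b => ψ y := by
    rw [funext hψ]
    exact hD.to_rightInverse e.symm_apply_apply
  exact ⟨ψ, ⟨hmono, hbij, ⟨C, hLip⟩, D, hanti⟩, Equiv.ext fun y => Subtype.ext (hψ y)⟩

lemma IsIncreasingLipeo.surjective_isometry {ψ : ℝ → ℝ} (hψ : IsIncreasingLipeo b a ψ) {ε : ℝ}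
    (hε : |ε| = 1) {S : lipZero (origin ha) →ₗ[ℝ] lipZero (origin hb)}
    (hS : ∀ f y, (S f).1 y = ε * f.1 (hψ.equiv y)) :
    Function.Surjective S ∧ ∀ f, ‖S f‖ = ‖f‖ := by
  refine ⟨fun g => ?_, fun f => ?_⟩
  · obtain ⟨hg0, C, hC⟩ := g.2
    obtain ⟨D, hD⟩ := hψ.exists_lipschitzWith_equiv_symm
    have h0 : hψ.equiv.symm (origin ha) = origin hb :=
      (Equiv.symm_apply_eq _).2 (Subtype.ext (hψ.apply_zero ha hb).symm)
    let f : lipZero (origin ha) := lipZero.ofLipschitz (hC.comp hD) (by simp [h0, hg0])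
    have hf (y : Icc 0 b) : f.1 (hψ.equiv y) = g.1 y :=
      congrArg g.1 (hψ.equiv.symm_apply_apply y)
    refine ⟨ε • f, Subtype.ext (ContinuousMap.ext fun y => ?_)⟩
    calc (S (ε • f)).1 y = ε * (ε * f.1 (hψ.equiv y)) := hS _ y
      _ = g.1 y := by rw [hf, ← mul_assoc, ← abs_mul_abs_self ε, hε, one_mul, one_mul]
  · have key (y : Icc 0 b) : ‖(S f).1 y‖ = ‖f.1 (hψ.equiv y)‖ := by
      rw [hS, norm_mul, Real.norm_eq_abs, hε, one_mul]
    rw [Submodule.coe_norm, Submodule.coe_norm, ContinuousMap.norm_eq_iSup_norm,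
      ContinuousMap.norm_eq_iSup_norm]
    exact hψ.equiv.iSup_congr fun y => (key y).symm

theorem surjective_isometry_iff_exists_lipeo (S : lipZero (origin ha) →ₗ[ℝ] lipZero (origin hb)) :
    (Function.Surjective S ∧ ∀ f, ‖S f‖ = ‖f‖) ↔
      ∃ ε : ℝ, (ε = 1 ∨ ε = -1) ∧ ∃ ψ, ∃ hψ : IsIncreasingLipeo b a ψ,
        ∀ f y, (S f).1 y = ε * f.1 (hψ.equiv y) := by
  constructor
  · rintro ⟨hsurj, hnorm⟩
    obtain ⟨ε, hε, e, he, he', he0, hS⟩ :=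
      exists_lipeo_of_linearIsometryEquiv (.ofSurjective ⟨S, hnorm⟩ hsurj)
    obtain ⟨ψ, hψ, rfl⟩ := exists_isIncreasingLipeo_equiv_eq he he' he0
    exact ⟨ε, hε, ψ, hψ, hS⟩
  · rintro ⟨ε, hε, ψ, hψ, hS⟩
    exact hψ.surjective_isometry ((abs_eq zero_le_one).2 hε) hS

end Interval

section Projection

variable {K : Set ℝ} {x t : ℝ}

lemma Icc_sInf_inter (hK : IsCompact K) (x : ℝ) : Icc (sInf K) x ∩ K = Iic x ∩ K := by
  ext u
  exact ⟨fun h => ⟨h.1.2, h.2⟩, fun h => ⟨⟨csInf_le hK.bddBelow h.2, h.1⟩, h.2⟩⟩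

lemma proj_eq (hK : IsCompact K) (x : ℝ) : proj K x = volume.real (Iic x ∩ K) := by
  rw [proj, Icc_sInf_inter hK]

lemma primitive_eq (hK : IsCompact K) (f : LInf K) (x : ℝ) :
    primitive K f x = ∫ u in Iic x ∩ K, f u := by
  rw [primitive, Icc_sInf_inter hK]

lemma volume_inter_ne_top (hK : IsCompact K) (s : Set ℝ) : volume (s ∩ K) ≠ ⊤ :=
  measure_ne_top_of_subset inter_subset_right hK.measure_lt_top.ne

lemma proj_mono (hK : IsCompact K) : Monotone (proj K) := fun x y h => by
  rw [proj_eq hK, proj_eq hK]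
  exact measureReal_mono (inter_subset_inter_left _ (Iic_subset_Iic.2 h))
    (volume_inter_ne_top hK _)

lemma proj_mem_Icc (hK : IsCompact K) (x : ℝ) : proj K x ∈ Icc 0 (volume.real K) :=
  ⟨measureReal_nonneg, measureReal_mono inter_subset_right hK.measure_lt_top.ne⟩

lemma proj_lipschitz (hK : IsCompact K) : LipschitzWith 1 (proj K) := by
  refine LipschitzWith.of_le_add fun x y => ?_
  rcases le_total x y with h | h
  · exact (proj_mono hK h).trans (le_add_of_nonneg_right dist_nonneg)
  · have hsub : Iic x ∩ K ⊆ (Iic y ∩ K) ∪ Icc y x := fun u hu =>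
      (le_total u y).imp (fun h' => ⟨h', hu.2⟩) fun h' => ⟨h', hu.1⟩
    calc proj K x ≤ volume.real ((Iic y ∩ K) ∪ Icc y x) := proj_eq hK x ▸ measureReal_mono hsub
          (measure_union_ne_top (volume_inter_ne_top hK _) measure_Icc_lt_top.ne)
      _ ≤ volume.real (Iic y ∩ K) + volume.real (Icc y x) := measureReal_union_le _ _
      _ = proj K y + dist x y := by
        rw [← proj_eq hK, Real.volume_real_Icc_of_le h, Real.dist_eq,
          abs_of_nonneg (sub_nonneg.2 h)]

lemma proj_sInf : proj K (sInf K) = 0 := by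
  rw [proj, Icc_self, measureReal_def,
    measure_mono_null inter_subset_left Real.volume_singleton, ENNReal.toReal_zero]

lemma proj_sSup (hK : IsCompact K) : proj K (sSup K) = volume.real K := by
  have hsub : K ⊆ Iic (sSup K) := fun x hx => le_csSup hK.bddAbove hx
  rw [proj_eq hK, inter_eq_right.2 hsub]

lemma exists_mem_le_proj_eq (hK : IsCompact K) (hne : K.Nonempty) (hx : sInf K ≤ x) :
    ∃ m ∈ K, m ≤ x ∧ proj K m = proj K x := by
  have hc : IsCompact (Iic x ∩ K) := hK.inter_left isClosed_Iic
  have hm : sSup (Iic x ∩ K) ∈ Iic x ∩ K := hc.sSup_mem ⟨sInf K, hx, hK.sInf_mem hne⟩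
  refine ⟨_, hm.2, hm.1, ?_⟩
  rw [proj_eq hK, proj_eq hK]
  congr 1
  ext u
  exact ⟨fun h => ⟨mem_Iic.2 (h.1.trans hm.1), h.2⟩, fun h => ⟨le_csSup hc.bddAbove h, h.2⟩⟩

lemma image_proj (hK : IsCompact K) (hne : K.Nonempty) :
    proj K '' K = Icc 0 (volume.real K) := by
  refine (image_subset_iff.2 fun x _ => mem_preimage.2 (proj_mem_Icc hK x)).antisymm fun t ht => ?_
  have hle : sInf K ≤ sSup K := csInf_le_csSup hne hK.bddBelow hK.bddAbove
  rw [← proj_sSup hK, ← proj_sInf (K := K)] at ht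
  obtain ⟨x, hx, rfl⟩ :=
    intermediate_value_Icc hle (proj_lipschitz hK).continuous.continuousOn ht
  obtain ⟨m, hm, -, hmx⟩ := exists_mem_le_proj_eq hK hne hx.1
  exact ⟨m, hm, hmx⟩

lemma sel_mem_fiber (hK : IsCompact K) (hne : K.Nonempty) (ht : t ∈ Icc 0 (volume.real K)) :
    sel K t ∈ K ∧ proj K (sel K t) = t := by
  have hc : IsCompact {x ∈ K | proj K x = t} :=
    hK.inter_right (isClosed_singleton.preimage (proj_lipschitz hK).continuous)
  exact hc.sInf_mem (by rwa [← image_proj hK hne] at ht)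

lemma proj_sel (hK : IsCompact K) (hne : K.Nonempty) (ht : t ∈ Icc 0 (volume.real K)) :
    proj K (sel K t) = t :=
  (sel_mem_fiber hK hne ht).2

lemma sel_proj_le (hK : IsCompact K) (hx : x ∈ K) : sel K (proj K x) ≤ x :=
  csInf_le (hK.bddBelow.mono fun _ h => h.1) ⟨hx, rfl⟩

lemma sel_monotoneOn (hK : IsCompact K) (hne : K.Nonempty) :
    MonotoneOn (sel K) (Icc 0 (volume.real K)) := by
  intro s hs t ht hst
  by_contra! h
  have hts := proj_mono hK h.le
  rw [proj_sel hK hne hs, proj_sel hK hne ht] at hts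
  exact h.ne' (by rw [hst.antisymm hts])

lemma sel_le_iff (hK : IsCompact K) (hne : K.Nonempty) (ht : t ∈ Icc 0 (volume.real K))
    (hx : sInf K ≤ x) : sel K t ≤ x ↔ t ≤ proj K x := by
  refine ⟨fun h => ?_, fun h => ?_⟩
  · rw [← proj_sel hK hne ht]
    exact proj_mono hK h
  · obtain ⟨m, hm, hmx, hproj⟩ := exists_mem_le_proj_eq hK hne hx
    rw [← hproj] at h
    exact ((sel_monotoneOn hK hne ht (proj_mem_Icc hK m) h).trans (sel_proj_le hK hm)).trans hmx

lemma preimage_sel_Iic (hK : IsCompact K) (hne : K.Nonempty) (hx : sInf K ≤ x) :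
    sel K ⁻¹' Iic x ∩ Icc 0 (volume.real K) = Icc 0 (proj K x) := by
  ext t
  constructor
  · rintro ⟨htx, ht⟩
    exact ⟨ht.1, (sel_le_iff hK hne ht hx).1 htx⟩
  · intro ht
    have ht' : t ∈ Icc 0 (volume.real K) := ⟨ht.1, ht.2.trans (proj_mem_Icc hK x).2⟩
    exact ⟨(sel_le_iff hK hne ht' hx).2 ht.2, ht'⟩

lemma aemeasurable_sel (hK : IsCompact K) (hne : K.Nonempty) :
    AEMeasurable (sel K) (volume.restrict (Icc 0 (volume.real K))) :=
  aemeasurable_restrict_of_monotoneOn measurableSet_Icc (sel_monotoneOn hK hne)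

/-- The quantile transform for Lebesgue measure on `K`, whose distribution function is `proj K`. -/
theorem map_sel (hK : IsCompact K) (hne : K.Nonempty) :
    (volume.restrict (Icc 0 (volume.real K))).map (sel K) = volume.restrict K := by
  refine Measure.ext_of_Iic _ _ fun x => ?_
  rw [Measure.map_apply_of_aemeasurable (aemeasurable_sel hK hne) measurableSet_Iic,
    Measure.restrict_apply' measurableSet_Icc, Measure.restrict_apply measurableSet_Iic]
  rcases lt_or_ge x (sInf K) with hx | hx
  · have hlt {u : ℝ} (hu : u ∈ K) : ¬u ≤ x := (hx.trans_le (csInf_le hK.bddBelow hu)).not_ge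
    have hsel : sel K ⁻¹' Iic x ∩ Icc 0 (volume.real K) = ∅ :=
      eq_empty_of_forall_notMem fun t ht => hlt (sel_mem_fiber hK hne ht.2).1 ht.1
    have hIic : Iic x ∩ K = ∅ := eq_empty_of_forall_notMem fun u hu => hlt hu.2 hu.1
    rw [hsel, hIic]
  · rw [preimage_sel_Iic hK hne hx, Real.volume_Icc, sub_zero, proj_eq hK, measureReal_def,
      ENNReal.ofReal_toReal (volume_inter_ne_top hK _)]

lemma map_proj (hK : IsCompact K) (hne : K.Nonempty) :
    (volume.restrict K).map (proj K) = volume.restrict (Icc 0 (volume.real K)) := by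
  rw [← map_sel hK hne, AEMeasurable.map_map_of_aemeasurable
    (proj_mono hK).measurable.aemeasurable (aemeasurable_sel hK hne)]
  refine (Measure.map_congr ?_).trans Measure.map_id
  filter_upwards [ae_restrict_mem measurableSet_Icc] with t ht using proj_sel hK hne ht

lemma ae_sel_proj (hK : IsCompact K) (hne : K.Nonempty) :
    ∀ᵐ x ∂volume.restrict K, sel K (proj K x) = x := by
  have hmono : Monotone fun x => sel K (proj K x) := fun x y h =>
    sel_monotoneOn hK hne (proj_mem_Icc hK x) (proj_mem_Icc hK y) (proj_mono hK h)
  have hmeas : MeasurableSet {x | sel K (proj K x) = x} :=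
    measurableSet_eq_fun hmono.measurable measurable_id
  rw [← map_sel hK hne, ae_map_iff (aemeasurable_sel hK hne) hmeas]
  filter_upwards [ae_restrict_mem measurableSet_Icc] with t ht
  rw [proj_sel hK hne ht]

theorem ae_comp_sel_iff (hK : IsCompact K) (hne : K.Nonempty) {p : ℝ → Prop} :
    (∀ᵐ t ∂volume.restrict (Icc 0 (volume.real K)), p (sel K t)) ↔
      ∀ᵐ x ∂volume.restrict K, p x := by
  constructor <;> intro h
  · rw [← map_proj hK hne] at h
    filter_upwards [ae_of_ae_map (proj_mono hK).measurable.aemeasurable h, ae_sel_proj hK hne]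
      with x hx hsel
    rwa [hsel] at hx
  · rw [← map_sel hK hne] at h
    exact ae_of_ae_map (aemeasurable_sel hK hne) h

end Projection

section Calculus

variable {a b : ℝ} {C D : ℝ≥0} {F G F' G' : ℝ → ℝ}

lemma ae_hasDerivAt_of_lipschitzOnWith (hF : LipschitzOnWith C F (Icc a b)) :
    ∀ᵐ t ∂volume.restrict (Icc a b), HasDerivAt F (derivWithin F (Icc a b) t) t := by
  have hdiff := hF.ae_differentiableWithinAt_real measurableSet_Icc
  rw [← restrict_Ioo_eq_restrict_Icc] at hdiff ⊢
  filter_upwards [hdiff, ae_restrict_mem measurableSet_Ioo] with t h ht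
  exact h.hasDerivWithinAt.hasDerivAt (Icc_mem_nhds ht.1 ht.2)

theorem eqOn_Icc_iff_ae_eq_of_hasDerivAt (hab : a ≤ b) (hF : LipschitzOnWith C F (Icc a b))
    (hG : LipschitzOnWith D G (Icc a b)) (ha : F a = G a)
    (hF' : ∀ᵐ t ∂volume.restrict (Icc a b), HasDerivAt F (F' t) t)
    (hG' : ∀ᵐ t ∂volume.restrict (Icc a b), HasDerivAt G (G' t) t) :
    EqOn F G (Icc a b) ↔ ∀ᵐ t ∂volume.restrict (Icc a b), F' t = G' t := by
  constructor
  · intro h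
    rw [← restrict_Ioo_eq_restrict_Icc] at hF' hG' ⊢
    filter_upwards [hF', hG', ae_restrict_mem measurableSet_Ioo] with t hFt hGt ht
    exact hFt.unique (hGt.congr_of_eventuallyEq (h.eventuallyEq_of_mem (Icc_mem_nhds ht.1 ht.2)))
  · intro h t ht
    rw [← uIcc_of_le hab] at hF hG hF' hG' h ht
    have hderiv : ∀ᵐ t ∂volume.restrict (uIcc a b), HasDerivAt (F - G) 0 t := by
      filter_upwards [hF', hG', h] with t hFt hGt heq
      simpa [heq] using hFt.sub hGt
    obtain ⟨c, hc⟩ := (hF.absolutelyContinuousOnInterval.sub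
      hG.absolutelyContinuousOnInterval).const_of_ae_hasDerivAt_zero
      ((ae_restrict_iff' measurableSet_uIcc).1 hderiv)
    have hc0 := hc a left_mem_uIcc
    have hct := hc t ht
    rw [Pi.sub_apply] at hc0 hct
    linarith

open Measure in
lemma IsIncreasingLipeo.ae_comp {ψ : ℝ → ℝ} (hψ : IsIncreasingLipeo b a ψ) {p : ℝ → Prop}
    (hp : ∀ᵐ t ∂volume.restrict (Icc 0 a), p t) :
    ∀ᵐ s ∂volume.restrict (Icc 0 b), p (ψ s) := by
  rw [ae_restrict_iff' measurableSet_Icc, ae_iff, ← hausdorffMeasure_real] at hp ⊢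
  obtain ⟨D, hD⟩ := hψ.antilipschitz
  set N := {t | ¬(t ∈ Icc 0 a → p t)}
  refine measure_mono_null (t := (↑) '' ((fun s : Icc 0 b => ψ s) ⁻¹' N)) ?_ ?_
  · intro s hs
    obtain ⟨hs, hps⟩ := Classical.not_imp.1 hs
    exact ⟨⟨s, hs⟩, fun h => hps (h (hψ.bijOn.mapsTo hs)), rfl⟩
  · rw [isometry_subtype_coe.hausdorffMeasure_image (.inl zero_le_one)]
    refine le_antisymm ((hD.hausdorffMeasure_preimage_le zero_le_one N).trans_eq ?_) zero_le
    rw [hp, mul_zero]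

end Calculus

section Primitive

variable {K : Set ℝ} {x t : ℝ}

/-- The primitive `J_K f`, transported to `[0, |K|]` by the selector `sel K`. -/
noncomputable def selPrimitive (K : Set ℝ) (f : LInf K) (t : ℝ) : ℝ :=
  ∫ u in 0..t, f (sel K u)

lemma aestronglyMeasurable_map_sel (hK : IsCompact K) (hne : K.Nonempty) (f : LInf K) :
    AEStronglyMeasurable f ((volume.restrict (Icc 0 (volume.real K))).map (sel K)) :=
  (map_sel hK hne).symm ▸ Lp.aestronglyMeasurable f

theorem primitive_eq_selPrimitive_proj (hK : IsCompact K) (hne : K.Nonempty) (f : LInf K)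
    (hx : x ∈ K) : primitive K f x = selPrimitive K f (proj K x) := by
  calc primitive K f x = ∫ u in Iic x, f u ∂volume.restrict K := by
        rw [primitive_eq hK, Measure.restrict_restrict measurableSet_Iic]
    _ = ∫ t in sel K ⁻¹' Iic x, f (sel K t) ∂volume.restrict (Icc 0 (volume.real K)) := by
        rw [← setIntegral_map measurableSet_Iic (aestronglyMeasurable_map_sel hK hne f)
          (aemeasurable_sel hK hne), map_sel hK hne]
    _ = ∫ t in Icc 0 (proj K x), f (sel K t) := by
        rw [Measure.restrict_restrict' measurableSet_Icc,
          preimage_sel_Iic hK hne (csInf_le hK.bddBelow hx)]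
    _ = selPrimitive K f (proj K x) := by
        rw [selPrimitive, intervalIntegral.integral_of_le (proj_mem_Icc hK x).1,
          integral_Icc_eq_integral_Ioc]

lemma ae_norm_comp_sel_le (hK : IsCompact K) (hne : K.Nonempty) (f : LInf K) :
    ∀ᵐ t ∂volume.restrict (Icc 0 (volume.real K)), ‖f (sel K t)‖ ≤ ‖f‖ := by
  refine (ae_comp_sel_iff hK hne (p := fun x => ‖f x‖ ≤ ‖f‖)).2 ?_
  have h := ae_le_lpNorm_exponent_top (Lp.memLp f)
  simpa [Lp.norm_def, ← toReal_eLpNorm (Lp.aestronglyMeasurable f)] using h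

lemma intervalIntegrable_comp_sel (hK : IsCompact K) (hne : K.Nonempty) (f : LInf K)
    (ht : t ∈ Icc 0 (volume.real K)) :
    IntervalIntegrable (fun u => f (sel K u)) volume 0 t := by
  have h : IntegrableOn (fun u => f (sel K u)) (Icc 0 (volume.real K)) :=
    Integrable.of_bound
      ((aestronglyMeasurable_map_sel hK hne f).comp_aemeasurable (aemeasurable_sel hK hne))
      ‖f‖ (ae_norm_comp_sel_le hK hne f)
  exact (h.mono_set (uIcc_subset_Icc (left_mem_Icc.2 measureReal_nonneg) ht)).intervalIntegrable

lemma selPrimitive_lipschitzOnWith (hK : IsCompact K) (hne : K.Nonempty) (f : LInf K) :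
    LipschitzOnWith ‖f‖₊ (selPrimitive K f) (Icc 0 (volume.real K)) := by
  refine LipschitzOnWith.of_dist_le_mul fun s hs t ht => ?_
  rw [Real.dist_eq, Real.dist_eq, selPrimitive, selPrimitive,
    intervalIntegral.integral_interval_sub_left (intervalIntegrable_comp_sel hK hne f hs)
      (intervalIntegrable_comp_sel hK hne f ht)]
  refine intervalIntegral.norm_integral_le_of_norm_le_const_ae (E := ℝ) ?_
  filter_upwards [(ae_restrict_iff' measurableSet_Icc).1 (ae_norm_comp_sel_le hK hne f)]
    with u hu hust using hu (uIcc_subset_Icc ht hs (uIoc_subset_uIcc hust))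

lemma selPrimitive_zero (f : LInf K) : selPrimitive K f 0 = 0 :=
  intervalIntegral.integral_same

lemma ae_hasDerivAt_selPrimitive (hK : IsCompact K) (hne : K.Nonempty) (f : LInf K) :
    ∀ᵐ t ∂volume.restrict (Icc 0 (volume.real K)),
      HasDerivAt (selPrimitive K f) (f (sel K t)) t := by
  have hle : (0 : ℝ) ≤ volume.real K := measureReal_nonneg
  rw [ae_restrict_iff' measurableSet_Icc]
  filter_upwards [(intervalIntegrable_comp_sel hK hne f
    (right_mem_Icc.2 hle)).ae_hasDerivAt_integral] with t ht htK
  rw [← uIcc_of_le hle] at htK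
  exact ht htK 0 left_mem_uIcc

lemma selPrimitive_congr (hK : IsCompact K) (hne : K.Nonempty) {f : LInf K} {g : ℝ → ℝ}
    (hfg : f =ᵐ[volume.restrict K] g) (ht : t ∈ Icc 0 (volume.real K)) :
    selPrimitive K f t = ∫ u in 0..t, g (sel K u) := by
  refine intervalIntegral.integral_congr_ae ?_
  filter_upwards [(ae_restrict_iff' measurableSet_Icc).1
    ((ae_comp_sel_iff hK hne (p := fun x => f x = g x)).2 hfg)] with u hu hut
  exact hu (uIcc_subset_Icc (left_mem_Icc.2 measureReal_nonneg) ht (uIoc_subset_uIcc hut))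

lemma selPrimitive_add (hK : IsCompact K) (hne : K.Nonempty) (f g : LInf K)
    (ht : t ∈ Icc 0 (volume.real K)) :
    selPrimitive K (f + g) t = selPrimitive K f t + selPrimitive K g t :=
  (selPrimitive_congr hK hne (Lp.coeFn_add f g) ht).trans
    (intervalIntegral.integral_add (intervalIntegrable_comp_sel hK hne f ht)
      (intervalIntegrable_comp_sel hK hne g ht))

lemma selPrimitive_smul (hK : IsCompact K) (hne : K.Nonempty) (c : ℝ) (f : LInf K)
    (ht : t ∈ Icc 0 (volume.real K)) :
    selPrimitive K (c • f) t = c * selPrimitive K f t :=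
  (selPrimitive_congr hK hne (Lp.coeFn_smul c f) ht).trans
    (intervalIntegral.integral_const_mul c _)

theorem selPrimitive_injective (hK : IsCompact K) (hne : K.Nonempty) {f g : LInf K}
    (h : EqOn (selPrimitive K f) (selPrimitive K g) (Icc 0 (volume.real K))) : f = g :=
  Lp.ext <| (ae_comp_sel_iff hK hne).1 <|
    (eqOn_Icc_iff_ae_eq_of_hasDerivAt measureReal_nonneg (selPrimitive_lipschitzOnWith hK hne f)
      (selPrimitive_lipschitzOnWith hK hne g) (by rw [selPrimitive_zero, selPrimitive_zero])
      (ae_hasDerivAt_selPrimitive hK hne f) (ae_hasDerivAt_selPrimitive hK hne g)).1 h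

theorem exists_selPrimitive_eq (hK : IsCompact K) (hne : K.Nonempty) {F : ℝ → ℝ} {C : ℝ≥0}
    (hF : LipschitzWith C F) (h0 : F 0 = 0) :
    ∃ f : LInf K, EqOn (selPrimitive K f) F (Icc 0 (volume.real K)) := by
  have hmem : MemLp (fun x => deriv F (proj K x)) ⊤ (volume.restrict K) :=
    memLp_top_of_bound
      ((measurable_deriv F).comp (proj_mono hK).measurable).aestronglyMeasurable C
      (.of_forall fun x => norm_deriv_le_of_lipschitz hF)
  refine ⟨hmem.toLp _, ?_⟩
  refine (eqOn_Icc_iff_ae_eq_of_hasDerivAt measureReal_nonneg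
    (selPrimitive_lipschitzOnWith hK hne _) hF.lipschitzOnWith (by rw [selPrimitive_zero, h0])
    (ae_hasDerivAt_selPrimitive hK hne _)
    (ae_restrict_of_ae (hF.ae_differentiableAt_real.mono fun t ht => ht.hasDerivAt))).2 ?_
  filter_upwards [(ae_comp_sel_iff hK hne (p := fun x => hmem.toLp _ x = deriv F (proj K x))).2
    hmem.coeFn_toLp, ae_restrict_mem measurableSet_Icc] with t ht htK
  rw [ht, proj_sel hK hne htK]

/-- The operator `f ↦ J_K f` into the Lipschitz functions on `[0, |K|]` vanishing at `0`, with the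
domain of the primitives moved from `K` to `[0, |K|]` by `sel K`. -/
noncomputable def primitiveMap (hK : IsCompact K) (hne : K.Nonempty) :
    LInf K →ₗ[ℝ] lipZero (origin (measureReal_nonneg : 0 ≤ volume.real K)) where
  toFun f := lipZero.ofLipschitz (f := fun t : Icc 0 (volume.real K) => selPrimitive K f t)
    (lipschitzOnWith_iff_restrict.1 (selPrimitive_lipschitzOnWith hK hne f)) (selPrimitive_zero f)
  map_add' f g := Subtype.ext <| ContinuousMap.ext fun t => selPrimitive_add hK hne f g t.2
  map_smul' c f := Subtype.ext <| ContinuousMap.ext fun t => selPrimitive_smul hK hne c f t.2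

theorem primitiveMap_bijective (hK : IsCompact K) (hne : K.Nonempty) :
    Function.Bijective (primitiveMap hK hne) := by
  refine ⟨fun f g h => selPrimitive_injective hK hne fun t ht => ?_, ?_⟩
  · exact DFunLike.congr_fun (congrArg Subtype.val h) ⟨t, ht⟩
  · rintro ⟨F, h0, C, hF⟩
    obtain ⟨f, hf⟩ := exists_selPrimitive_eq hK hne
      (hF.comp (LipschitzWith.projIcc measureReal_nonneg))
      ((congrArg F (projIcc_left _)).trans h0)
    refine ⟨f, Subtype.ext <| ContinuousMap.ext fun t => (hf t.2).trans ?_⟩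
    exact congrArg F (projIcc_val _ t)

/-- `primitiveMap` as an isomorphism; it is isometric for the Alexiewicz norm. -/
noncomputable def primitiveEquiv (hK : IsCompact K) (hne : K.Nonempty) :
    LInf K ≃ₗ[ℝ] lipZero (origin (measureReal_nonneg : 0 ≤ volume.real K)) :=
  .ofBijective (primitiveMap hK hne) (primitiveMap_bijective hK hne)

theorem norm_primitiveEquiv (hK : IsCompact K) (hne : K.Nonempty) (f : LInf K) :
    ‖primitiveEquiv hK hne f‖ = alexNorm K f := by
  have himage : (fun x => |primitive K f x|) '' K =
      range fun t : Icc 0 (volume.real K) => |selPrimitive K f t| := by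
    rw [image_congr fun x hx => congrArg abs (primitive_eq_selPrimitive_proj hK hne f hx),
      ← image_image (fun t => |selPrimitive K f t|) (proj K), image_proj hK hne, image_eq_range]
  rw [alexNorm, himage]
  exact (primitiveEquiv hK hne f).1.norm_eq_iSup_norm

end Primitive

section Lift

variable {K M : Set ℝ} {ψ : ℝ → ℝ}

lemma forall_primitive_lift_iff (hK : IsCompact K) (hneK : K.Nonempty) (hM : IsCompact M)
    (hneM : M.Nonempty) (hψ : IsIncreasingLipeo (volume.real M) (volume.real K) ψ)
    (f : LInf K) (g : LInf M) (ε : ℝ) :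
    (∀ y ∈ M, primitive M g y = ε * primitive K f (lift K M ψ y)) ↔
      EqOn (selPrimitive M g) (fun s => ε * selPrimitive K f (ψ s)) (Icc 0 (volume.real M)) := by
  rw [← image_proj hM hneM]
  refine Iff.trans (forall₂_congr fun y hy => ?_) forall_mem_image.symm
  have hsel := sel_mem_fiber hK hneK (hψ.bijOn.mapsTo (proj_mem_Icc hM y))
  rw [primitive_eq_selPrimitive_proj hM hneM g hy,
    lift, primitive_eq_selPrimitive_proj hK hneK f hsel.1, hsel.2]

theorem forall_primitive_lift_iff_ae (hK : IsCompact K) (hneK : K.Nonempty) (hM : IsCompact M)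
    (hneM : M.Nonempty) (hψ : IsIncreasingLipeo (volume.real M) (volume.real K) ψ)
    (f : LInf K) (g : LInf M) (ε : ℝ) :
    (∀ y ∈ M, primitive M g y = ε * primitive K f (lift K M ψ y)) ↔
      ∀ᵐ y ∂volume.restrict M, g y =
        ε * f (lift K M ψ y) * derivWithin ψ (Icc 0 (volume.real M)) (proj M y) := by
  obtain ⟨C, hC⟩ := hψ.lipschitz
  have hLip : LipschitzOnWith (‖ε‖₊ * (‖f‖₊ * C)) (fun s => ε * selPrimitive K f (ψ s))
      (Icc 0 (volume.real M)) :=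
    (lipschitzWith_smul ε).comp_lipschitzOnWith
      ((selPrimitive_lipschitzOnWith hK hneK f).comp hC hψ.bijOn.mapsTo)
  have hzero : selPrimitive M g 0 = ε * selPrimitive K f (ψ 0) := by
    rw [hψ.apply_zero measureReal_nonneg measureReal_nonneg, selPrimitive_zero, selPrimitive_zero,
      mul_zero]
  have hderiv : ∀ᵐ s ∂volume.restrict (Icc 0 (volume.real M)),
      HasDerivAt (fun s => ε * selPrimitive K f (ψ s))
        (ε * (f (sel K (ψ s)) * derivWithin ψ (Icc 0 (volume.real M)) s)) s := by
    filter_upwards [hψ.ae_comp (ae_hasDerivAt_selPrimitive hK hneK f),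
      ae_hasDerivAt_of_lipschitzOnWith hC] with s hf hs
    exact (hf.comp s hs).const_mul ε
  rw [forall_primitive_lift_iff hK hneK hM hneM hψ,
    eqOn_Icc_iff_ae_eq_of_hasDerivAt measureReal_nonneg (selPrimitive_lipschitzOnWith hM hneM g)
      hLip hzero (ae_hasDerivAt_selPrimitive hM hneM g) hderiv, ← ae_comp_sel_iff hM hneM]
  refine Filter.eventually_congr ?_
  filter_upwards [ae_restrict_mem measurableSet_Icc] with s hs
  rw [lift, proj_sel hM hneM hs, mul_assoc]

theorem isSurjectiveIsometry_iff_exists_lipeo (hK : IsCompact K) (hneK : K.Nonempty)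
    (hM : IsCompact M) (hneM : M.Nonempty) (T : LInf K →ₗ[ℝ] LInf M) :
    IsSurjectiveIsometry T ↔ ∃ ε : ℝ, (ε = 1 ∨ ε = -1) ∧ ∃ ψ : ℝ → ℝ,
      IsIncreasingLipeo (volume.real M) (volume.real K) ψ ∧ ∀ f : LInf K,
        ∀ y ∈ M, primitive M (T f) y = ε * primitive K f (lift K M ψ y) := by
  set J := primitiveEquiv hK hneK
  set S := (primitiveEquiv hM hneM).toLinearMap ∘ₗ T ∘ₗ J.symm.toLinearMap
  have hS (f : LInf K) : S (J f) = primitiveEquiv hM hneM (T f) := by simp [S]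
  have hiso : IsSurjectiveIsometry T ↔ Function.Surjective S ∧ ∀ F, ‖S F‖ = ‖F‖ := by
    refine and_congr ?_ ?_
    · simp [S]
    · rw [J.surjective.forall]
      simp only [hS, J, norm_primitiveEquiv]
  rw [hiso, surjective_isometry_iff_exists_lipeo]
  refine exists_congr fun ε => and_congr_right fun _ => exists_congr fun ψ => ?_
  rw [← exists_prop]
  refine exists_congr fun hψ => ?_
  rw [J.surjective.forall]
  refine forall_congr' fun f => ?_
  rw [forall_primitive_lift_iff hK hneK hM hneM hψ, hS]
  exact Subtype.forall

end Lift

end Alexiewicz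

theorem theorem1p1 (K M : Set ℝ) (hK : IsCompact K) (hM : IsCompact M)
    (hKpos : 0 < MeasureTheory.volume K) (hMpos : 0 < MeasureTheory.volume M)
    (T : Alexiewicz.LInf K →ₗ[ℝ] Alexiewicz.LInf M) :
    (Alexiewicz.IsSurjectiveIsometry T ↔
      ∃ ε : ℝ, (ε = 1 ∨ ε = -1) ∧
        ∃ ψ : ℝ → ℝ,
          Alexiewicz.IsIncreasingLipeo
            (MeasureTheory.volume.real M) (MeasureTheory.volume.real K) ψ ∧
          ∀ f : Alexiewicz.LInf K, ∀ y ∈ M,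
            Alexiewicz.primitive M (T f) y
              = ε * Alexiewicz.primitive K f (Alexiewicz.lift K M ψ y)) ∧
    (∀ ε : ℝ, (ε = 1 ∨ ε = -1) →
      ∀ ψ : ℝ → ℝ,
        Alexiewicz.IsIncreasingLipeo
          (MeasureTheory.volume.real M) (MeasureTheory.volume.real K) ψ →
        ∀ f : Alexiewicz.LInf K,
          ((∀ y ∈ M,
            Alexiewicz.primitive M (T f) y
              = ε * Alexiewicz.primitive K f (Alexiewicz.lift K M ψ y)) ↔
          ∀ᵐ y ∂(MeasureTheory.volume.restrict M),
            (T f) y = ε * f (Alexiewicz.lift K M ψ y) *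
              derivWithin ψ (Set.Icc 0 (MeasureTheory.volume.real M))
                (Alexiewicz.proj M y))) := by
  have hneK : K.Nonempty := MeasureTheory.nonempty_of_measure_ne_zero hKpos.ne'
  have hneM : M.Nonempty := MeasureTheory.nonempty_of_measure_ne_zero hMpos.ne'
  exact ⟨Alexiewicz.isSurjectiveIsometry_iff_exists_lipeo hK hneK hM hneM T,
    fun ε _ ψ hψ f => Alexiewicz.forall_primitive_lift_iff_ae hK hneK hM hneM hψ f (T f) ε⟩
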